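/- Let $n>1$ and $d>1$ be integers, and let $\mathbb{E}=\mathbb{R}[X_1,\dots,X_n]_d$ be the space of real homogeneous polynomials of degree $d$ in $n$ variables (including $0$), with the Bombieri norm $$\Big\|\sum_{|\alpha|=d}a_\alpha x^\alpha\Big\|^2=\sum_{|\alpha|=d}\frac{\alpha!}{d!}\,a_\alpha^2 .$$ Let $\mathcal{S}^{n-1}$ be the unit sphere of $\mathbb{R}^n$, let $\Delta\subset\mathbb{E}$ be the real discriminant, that is, the set of $Q\in\mathbb{E}$ for which there is $x\in\mathcal{S}^{n-1}$ with $Q(x)=0$ and $\nabla Q(x)=0$, and let $\operatorname{dist}(P,\Delta)=\inf_{Q\in\Delta}\|P-Q\|$. Let $P\in\mathbb{E}$ satisfy $\operatorname{dist}(P,\Delta)\neq 0$. If $C$ and $D$ are two distinct connected components of the zero set $\{x\in\mathcal{S}^{n-1} : P(x)=0\}$, then their distance measured as arc length on the sphere, i.e. $\inf_{x\in C,\,y\in D}\arccos\langle x,y\rangle$, satisfies $$\inf_{x\in C,\;y\in D}\arccos\langle x,y\rangle\;\ge\;\frac{2}{d}\sqrt{\frac{2\operatorname{dist}(P,\Delta)}{\|P\|}}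 .$$ -/

import Mathlib

open MvPolynomial

noncomputable section

/-- The Bombieri scalar product: monomials are pairwise orthogonal and
`⟨x ^ α, x ^ α⟩ = α! / |α|!`. -/
def bombieriInner {n : ℕ} (P Q : MvPolynomial (Fin n) ℝ) : ℝ :=
  ∑ α ∈ P.support,
    ((∏ i, (α i).factorial : ℕ) : ℝ) / ((∑ i, α i).factorial : ℝ) * (P.coeff α * Q.coeff α)

/-- The Bombieri norm. -/
def bombieriNorm {n : ℕ} (P : MvPolynomial (Fin n) ℝ) : ℝ :=
  Real.sqrt (bombieriInner P P)

/-- The real discriminant in the space of real homogeneous polynomials of degree `d` in `n`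
variables: those with a real singular zero on the unit sphere. -/
def realDiscriminant (n d : ℕ) : Set (MvPolynomial (Fin n) ℝ) :=
  {Q | Q ∈ homogeneousSubmodule (Fin n) ℝ d ∧
    ∃ x ∈ Metric.sphere (0 : EuclideanSpace ℝ (Fin n)) 1,
      eval (fun i => x i) Q = 0 ∧ ∀ i, eval (fun j => x j) (pderiv i Q) = 0}

/-- The distance to the real discriminant, for the Bombieri norm. -/
def distDiscriminant {n : ℕ} (d : ℕ) (P : MvPolynomial (Fin n) ℝ) : ℝ :=
  sInf ((fun Q => bombieriNorm (P - Q)) '' realDiscriminant n d)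

/-- The zero locus of `P` on the unit sphere. -/
def sphereZeros {n : ℕ} (P : MvPolynomial (Fin n) ℝ) : Set (EuclideanSpace ℝ (Fin n)) :=
  {x | x ∈ Metric.sphere (0 : EuclideanSpace ℝ (Fin n)) 1 ∧ eval (fun i => x i) P = 0}

/-- `C` is a connected component of the set `Z`. -/
def IsComponentOf {X : Type*} [TopologicalSpace X] (C Z : Set X) : Prop :=
  ∃ x ∈ Z, C = connectedComponentIn Z x

/-- The arc-length distance between two nonempty subsets of the unit sphere: the infimum of the
lengths of the shortest great-circle arcs joining a point of one to a point of the other (the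
length of such an arc is the angle between its end points). -/
def arcDist {n : ℕ} (C D : Set (EuclideanSpace ℝ (Fin n))) : ℝ :=
  sInf (Set.image2 InnerProductGeometry.angle C D)

end

/-! Suppose `x` and `y` lie in different components at an angle `θ` below the claimed bound, and
follow `P` along the great-circle arc from `x` to `y`. By Cauchy–Schwarz for the Bombieri product,
whose reproducing kernel is `⟨x, y⟩ ^ d`, the second derivative is at most `d² ‖P‖`. As `P` vanishes
at both ends, `|P| ≤ d² ‖P‖ θ² / 8` on the arc (`abs_eval_greatCircle_le`), and this is below
`dist(P, Δ)`.

On the other hand, a critical value of `P` on the sphere is at least `dist(P, Δ)` in absolute value: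
subtracting `P(x) ⟨x, ·⟩ ^ d` makes a critical point `x` singular, at Bombieri cost `|P(x)|`
(`distDiscriminant_le_abs_eval`). Hence for `c < dist(P, Δ)` the tangent gradient has no zero on
`{|P| ≤ c}`, and a small gradient step contracts `|P|` there while fixing its zeros
(`exists_contracting_map`).

Iterating the step on the arc yields connected sets through `x` and `y` on which `|P|` is
arbitrarily small. By compactness `x` and `y` then share a component, a contradiction. Only the sets
are iterated; no limit of the maps is needed. -/

/-! ### Components of a zero set as limits of connected sets -/

open Set in
/-- If two zeros of `f` in a compact set `K` lie in a common preconnected subset of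
`{|f| < ε} ∩ K` for every `ε > 0`, then they lie in the same component of the zero set. -/
theorem mem_connectedComponentIn_of_forall_preconnected {X : Type*} [TopologicalSpace X]
    [T2Space X] {K : Set X} (hK : IsCompact K) {f : X → ℝ} (hf : Continuous f) {x y : X}
    (hx : x ∈ K ∩ f ⁻¹' {0}) (hy : y ∈ K ∩ f ⁻¹' {0})
    (h : ∀ ε > 0, ∃ T ⊆ K, IsPreconnected T ∧ x ∈ T ∧ y ∈ T ∧ ∀ z ∈ T, |f z| < ε) :
    y ∈ connectedComponentIn (K ∩ f ⁻¹' {0}) x := by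
  set Z := K ∩ f ⁻¹' {0} with hZ
  have hZc : IsCompact Z := hK.inter_right (isClosed_singleton.preimage hf)
  have : CompactSpace Z := isCompact_iff_compactSpace.1 hZc
  by_contra hne
  rw [connectedComponentIn_eq_image hx] at hne
  have hne' : (⟨y, hy⟩ : Z) ∉ connectedComponent (⟨x, hx⟩ : Z) := fun hmem =>
    hne ⟨_, hmem, rfl⟩
  -- In a compact Hausdorff space components are intersections of clopen sets, so some clopen `U`
  -- separates `x` from `y`.
  rw [connectedComponent_eq_iInter_isClopen, mem_iInter] at hne'
  push Not at hne'
  obtain ⟨⟨U, hU, hxU⟩, hyU⟩ := hne'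
  have hA : IsCompact (Subtype.val '' U) := hU.isClosed.isCompact.image continuous_subtype_val
  have hB : IsCompact (Subtype.val '' Uᶜ) :=
    hU.compl.isClosed.isCompact.image continuous_subtype_val
  have hAB : Disjoint (Subtype.val '' U) (Subtype.val '' Uᶜ) :=
    (disjoint_image_iff Subtype.val_injective).2 disjoint_compl_right
  obtain ⟨V, W, hV, hW, hAV, hBW, hVW⟩ := SeparatedNhds.of_isCompact_isCompact hA hB hAB
  have hR : IsCompact (K \ (V ∪ W)) := hK.diff (hV.union hW)
  -- All zeros lie in `V ∪ W`, so `|f|` has a positive minimum on the compact remainder. A connected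
  -- set with smaller values cannot cross from `V` to `W`.
  have hε : ∃ ε > 0, ∀ z ∈ K \ (V ∪ W), ε ≤ |f z| := by
    rcases (K \ (V ∪ W)).eq_empty_or_nonempty with he | he
    · exact ⟨1, one_pos, by simp [he]⟩
    · obtain ⟨z, hz, hmin⟩ := hR.exists_isMinOn he hf.abs.continuousOn
      refine ⟨|f z|, abs_pos.2 fun h0 => hz.2 ?_, fun w hw => hmin hw⟩
      by_cases hzU : (⟨z, hz.1, h0⟩ : Z) ∈ U
      · exact Or.inl (hAV ⟨_, hzU, rfl⟩)
      · exact Or.inr (hBW ⟨_, hzU, rfl⟩)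
  obtain ⟨ε, hε, hle⟩ := hε
  obtain ⟨T, hTK, hT, hxT, hyT, hlt⟩ := h ε hε
  have hsub : T ⊆ V ∪ W := fun z hz => by
    by_contra hzn
    exact absurd (hlt z hz) (not_lt.2 (hle z ⟨hTK hz, hzn⟩))
  obtain ⟨z, -, hzV, hzW⟩ := hT V W hV hW hsub ⟨x, hxT, hAV ⟨_, hxU, rfl⟩⟩
    ⟨y, hyT, hBW ⟨⟨y, hy⟩, hyU, rfl⟩⟩
  exact disjoint_left.1 hVW hzV hzW

open Set in
/-- If a continuous self-map of `K` fixes the zeros of `f` and contracts `|f|` by a factor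
`ρ < 1`, then zeros of `f` joined by a preconnected subset of `K` lie in the same component of the
zero set. -/
theorem mem_connectedComponentIn_of_contracting {X : Type*} [TopologicalSpace X]
    [T2Space X] {K : Set X} (hK : IsCompact K) {f : X → ℝ} (hf : Continuous f) {Φ : X → X}
    (hΦ : ContinuousOn Φ K) (hmaps : MapsTo Φ K K) (hfix : ∀ z ∈ K, f z = 0 → Φ z = z)
    {ρ : ℝ} (hρ0 : 0 ≤ ρ) (hρ1 : ρ < 1) (hcontr : ∀ z ∈ K, |f (Φ z)| ≤ ρ * |f z|)
    {T : Set X} (hTK : T ⊆ K) (hT : IsPreconnected T) {x y : X} (hxT : x ∈ T) (hyT : y ∈ T)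
    (hx : f x = 0) (hy : f y = 0) :
    y ∈ connectedComponentIn (K ∩ f ⁻¹' {0}) x := by
  refine mem_connectedComponentIn_of_forall_preconnected hK hf ⟨hTK hxT, hx⟩ ⟨hTK hyT, hy⟩ ?_
  intro ε hε
  obtain ⟨c, hc⟩ : ∃ c : ℝ, ∀ z ∈ K, |f z| ≤ c := by
    obtain ⟨c, hc⟩ := hK.exists_bound_of_continuousOn hf.continuousOn
    exact ⟨c, hc⟩
  have hiter : ∀ k : ℕ, ∃ T ⊆ K, IsPreconnected T ∧ x ∈ T ∧ y ∈ T ∧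
      ∀ z ∈ T, |f z| ≤ ρ ^ k * c := by
    intro k
    induction k with
    | zero => exact ⟨T, hTK, hT, hxT, hyT, fun z hz => by simpa using hc z (hTK hz)⟩
    | succ k ih =>
      obtain ⟨S, hSK, hS, hxS, hyS, hb⟩ := ih
      refine ⟨Φ '' S, (image_mono hSK).trans hmaps.image_subset, hS.image Φ (hΦ.mono hSK),
        ⟨x, hxS, hfix x (hSK hxS) hx⟩, ⟨y, hyS, hfix y (hSK hyS) hy⟩, ?_⟩
      rintro _ ⟨z, hz, rfl⟩
      calc |f (Φ z)| ≤ ρ * |f z| := hcontr z (hSK hz)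
        _ ≤ ρ * (ρ ^ k * c) := mul_le_mul_of_nonneg_left (hb z hz) hρ0
        _ = ρ ^ (k + 1) * c := by ring
  have hlim : Filter.Tendsto (fun k : ℕ => ρ ^ k * c) Filter.atTop (nhds 0) := by
    simpa using (tendsto_pow_atTop_nhds_zero_of_lt_one hρ0 hρ1).mul_const c
  obtain ⟨k, hk⟩ := (hlim.eventually (gt_mem_nhds hε)).exists
  obtain ⟨S, hSK, hS, hxS, hyS, hb⟩ := hiter k
  exact ⟨S, hSK, hS, hxS, hyS, fun z hz => (hb z hz).trans_lt hk⟩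

/-! ### The Bombieri product in coordinates -/

/-- The coefficient of `P` at the exponent vector `k`. -/
noncomputable def coeffAt {n : ℕ} (P : MvPolynomial (Fin n) ℝ) (k : Fin n → ℕ) : ℝ :=
  P.coeff (Finsupp.equivFunOnFinite.symm k)

/-- A sum over the support of a form of degree `d` is a sum over all exponents of degree `d`. -/
theorem sum_support_eq_sum_piAntidiag {n d : ℕ} {P : MvPolynomial (Fin n) ℝ}
    (hP : P.IsHomogeneous d) (F : (Fin n →₀ ℕ) → ℝ) (hF : ∀ α, P.coeff α = 0 → F α = 0) :
    ∑ α ∈ P.support, F α =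
      ∑ k ∈ Finset.piAntidiag Finset.univ d, F (Finsupp.equivFunOnFinite.symm k) := by
  classical
  have hinj : Function.Injective (fun α : Fin n →₀ ℕ => (α : Fin n → ℕ)) := DFunLike.coe_injective
  calc ∑ α ∈ P.support, F α
      = ∑ α ∈ P.support, F (Finsupp.equivFunOnFinite.symm (α : Fin n → ℕ)) := by simp
    _ = ∑ k ∈ P.support.image (fun α : Fin n →₀ ℕ => (α : Fin n → ℕ)),
          F (Finsupp.equivFunOnFinite.symm k) := by
        rw [Finset.sum_image hinj.injOn]
    _ = _ := ?_
  refine Finset.sum_subset ?_ ?_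
  · intro k hk
    obtain ⟨α, hα, rfl⟩ := Finset.mem_image.1 hk
    have h := hP (mem_support_iff.1 hα)
    rw [Finsupp.weight_apply, Finsupp.sum_fintype _ _ (by simp)] at h
    simpa using h
  · intro k _ hk
    refine hF _ ?_
    by_contra h
    exact hk (Finset.mem_image.2 ⟨_, mem_support_iff.2 h, by simp⟩)

theorem eval_eq_sum_coeffAt {n d : ℕ} {P : MvPolynomial (Fin n) ℝ} (hP : P.IsHomogeneous d)
    (x : Fin n → ℝ) :
    eval x P = ∑ k ∈ Finset.piAntidiag Finset.univ d, coeffAt P k * ∏ i, x i ^ k i := by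
  rw [eval_eq', sum_support_eq_sum_piAntidiag hP _ (fun α h => by simp [h])]
  simp [coeffAt]

theorem factorial_ratio_eq_inv_multinomial {n : ℕ} (k : Fin n → ℕ) :
    ((∏ i, (k i).factorial : ℕ) : ℝ) / ((∑ i, k i).factorial : ℝ) =
      (Nat.multinomial Finset.univ k : ℝ)⁻¹ := by
  have h := Nat.multinomial_spec Finset.univ k
  have h1 : ((∏ i, (k i).factorial : ℕ) : ℝ) ≠ 0 := by
    exact_mod_cast (Finset.prod_ne_zero_iff.2 fun i _ => Nat.factorial_ne_zero _)
  have h2 : (Nat.multinomial Finset.univ k : ℝ) ≠ 0 := by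
    exact_mod_cast (Nat.multinomial_pos Finset.univ k).ne'
  rw [← h]
  push_cast at h1 ⊢
  field_simp

theorem bombieriInner_self_eq {n d : ℕ} {P : MvPolynomial (Fin n) ℝ} (hP : P.IsHomogeneous d) :
    bombieriInner P P = ∑ k ∈ Finset.piAntidiag Finset.univ d,
      (Nat.multinomial Finset.univ k : ℝ)⁻¹ * coeffAt P k ^ 2 := by
  rw [bombieriInner, sum_support_eq_sum_piAntidiag hP _ (fun α h => by simp [h])]
  refine Finset.sum_congr rfl fun k _ => ?_
  simp only [Finsupp.equivFunOnFinite_symm_apply_apply, coeffAt]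
  rw [factorial_ratio_eq_inv_multinomial, sq]

theorem bombieriNorm_nonneg {n : ℕ} (P : MvPolynomial (Fin n) ℝ) : 0 ≤ bombieriNorm P :=
  Real.sqrt_nonneg _

/-- The Cauchy–Schwarz inequality for the Bombieri norm, in coordinates. -/
theorem sum_coeffAt_mul_sq_le {n d : ℕ} {P : MvPolynomial (Fin n) ℝ} (hP : P.IsHomogeneous d)
    (φ : (Fin n → ℕ) → ℝ) :
    (∑ k ∈ Finset.piAntidiag Finset.univ d, coeffAt P k * φ k) ^ 2 ≤
      bombieriNorm P ^ 2 *
        ∑ k ∈ Finset.piAntidiag Finset.univ d, (Nat.multinomial Finset.univ k : ℝ) * φ k ^ 2 := by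
  have hw : ∀ k : Fin n → ℕ, (0 : ℝ) < Nat.multinomial Finset.univ k := fun k => by
    exact_mod_cast Nat.multinomial_pos Finset.univ k
  have hnn : 0 ≤ bombieriInner P P := by
    rw [bombieriInner_self_eq hP]
    exact Finset.sum_nonneg fun k _ => mul_nonneg (inv_nonneg.2 (hw k).le) (sq_nonneg _)
  rw [bombieriNorm, Real.sq_sqrt hnn, bombieriInner_self_eq hP]
  refine Finset.sum_sq_le_sum_mul_sum_of_sq_le_mul _
    (fun k _ => mul_nonneg (inv_nonneg.2 (hw k).le) (sq_nonneg _))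
    (fun k _ => mul_nonneg (hw k).le (sq_nonneg _)) fun k _ => le_of_eq ?_
  have := (hw k).ne'
  field_simp

/-- The multinomial theorem, read as the formula for the reproducing kernel of the Bombieri product.
-/
theorem sum_multinomial_mul_prod_pow {n : ℕ} (d : ℕ) (x y : Fin n → ℝ) :
    ∑ k ∈ Finset.piAntidiag Finset.univ d, (Nat.multinomial Finset.univ k : ℝ) *
      ((∏ i, x i ^ k i) * ∏ i, y i ^ k i) = (∑ i, x i * y i) ^ d := by
  rw [Finset.sum_pow_eq_sum_piAntidiag]
  refine Finset.sum_congr rfl fun k _ => ?_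
  simp [mul_pow, Finset.prod_mul_distrib]

/-! ### Powers of linear forms and critical values -/

/-- The linear form `y ↦ ∑ xᵢ yᵢ`. -/
noncomputable def dualForm {n : ℕ} (x : Fin n → ℝ) : MvPolynomial (Fin n) ℝ :=
  ∑ i, x i • X i

theorem dualForm_isHomogeneous {n : ℕ} (x : Fin n → ℝ) : (dualForm x).IsHomogeneous 1 := by
  refine IsHomogeneous.sum _ _ _ fun i _ => ?_
  rw [smul_eq_C_mul]
  simpa using (isHomogeneous_C (Fin n) (x i)).mul (isHomogeneous_X ℝ i)

theorem eval_dualForm {n : ℕ} (x y : Fin n → ℝ) : eval y (dualForm x) = ∑ i, x i * y i := by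
  simp [dualForm, smul_eval]

theorem pderiv_dualForm {n : ℕ} (x : Fin n → ℝ) (i : Fin n) :
    pderiv i (dualForm x) = C (x i) := by
  simp [dualForm, pderiv_X, Pi.single_apply, smul_eq_C_mul]

theorem smul_dualForm_pow_isHomogeneous {n : ℕ} (d : ℕ) (c : ℝ) (x : Fin n → ℝ) :
    (c • dualForm x ^ d).IsHomogeneous d := by
  rw [smul_eq_C_mul]
  simpa using (isHomogeneous_C (Fin n) c).mul ((dualForm_isHomogeneous x).pow d)

theorem coeffAt_smul_dualForm_pow {n d : ℕ} (c : ℝ) (x : Fin n → ℝ) {k : Fin n → ℕ}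
    (hk : k ∈ Finset.piAntidiag Finset.univ d) :
    coeffAt (c • dualForm x ^ d) k =
      c * ((Nat.multinomial Finset.univ k : ℝ) * ∏ i, x i ^ k i) := by
  have hk' : ∑ i, k i = d := by simpa using hk
  rw [coeffAt, coeff_smul, dualForm, coeff_linearCombination_X_pow_of_fintype,
    Finsupp.sum_fintype _ _ (by simp), Finsupp.prod_fintype _ _ (by simp),
    ← Finsupp.multinomial_of_support_subset (Finset.subset_univ _)]
  simp [hk']

theorem bombieriNorm_smul_dualForm_pow {n : ℕ} (d : ℕ) (c : ℝ) {x : Fin n → ℝ}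
    (hx : ∑ i, x i * x i = 1) : bombieriNorm (c • dualForm x ^ d) = |c| := by
  rw [bombieriNorm, bombieriInner_self_eq (smul_dualForm_pow_isHomogeneous d c x),
    ← Real.sqrt_sq_eq_abs]
  congr 1
  have h := sum_multinomial_mul_prod_pow d x x
  rw [hx, one_pow] at h
  rw [← mul_one (c ^ 2), ← h, Finset.mul_sum]
  refine Finset.sum_congr rfl fun k hk => ?_
  have hw : (Nat.multinomial Finset.univ k : ℝ) ≠ 0 := by
    exact_mod_cast (Nat.multinomial_pos Finset.univ k).ne'
  rw [coeffAt_smul_dualForm_pow c x hk]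
  field_simp

theorem sum_mul_self_of_norm_eq_one {n : ℕ} {x : EuclideanSpace ℝ (Fin n)} (hx : ‖x‖ = 1) :
    ∑ i, x i * x i = 1 := by
  have h := EuclideanSpace.real_norm_sq_eq x
  rw [hx] at h
  simpa [sq] using h.symm

/-- The value of `P` at a critical point of its restriction to the sphere bounds the distance to
the discriminant. -/
theorem distDiscriminant_le_abs_eval {n d : ℕ} {P : MvPolynomial (Fin n) ℝ}
    (hP : P.IsHomogeneous d) {x : EuclideanSpace ℝ (Fin n)} (hx : ‖x‖ = 1)
    (hcrit : ∀ i, eval (fun j => x j) (pderiv i P) = d * eval (fun j => x j) P * x i) :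
    distDiscriminant d P ≤ |eval (fun j => x j) P| := by
  have hxx := sum_mul_self_of_norm_eq_one hx
  set c := eval (fun j => x j) P with hc
  have hbdd : BddBelow ((fun Q => bombieriNorm (P - Q)) '' realDiscriminant n d) :=
    ⟨0, by rintro _ ⟨Q, -, rfl⟩; exact bombieriNorm_nonneg _⟩
  -- At `x`, the form `⟨x, ·⟩ ^ d` has value `1` and gradient `d x`, so both the value and the
  -- gradient of `P` are cancelled.
  refine csInf_le hbdd ⟨P - c • dualForm (fun j => x j) ^ d, ⟨?_, x, by simpa using hx, ?_, ?_⟩, ?_⟩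
  · exact Submodule.sub_mem _ hP (smul_dualForm_pow_isHomogeneous d c _)
  · simp [smul_eval, eval_dualForm, hxx, hc]
  · intro i
    rw [map_sub, map_sub, hcrit, smul_eq_C_mul, pderiv_C_mul, pderiv_pow, pderiv_dualForm]
    simp [eval_dualForm, hxx]
    ring
  · simp only [sub_sub_cancel]
    exact bombieriNorm_smul_dualForm_pow d c hxx

/-! ### Second derivatives along great circles -/

theorem iteratedDeriv_two_cos_pow (m : ℕ) :
    iteratedDeriv 2 (fun t : ℝ => Real.cos t ^ m) = fun t =>
      (m * (m - 1) : ℝ) * Real.cos t ^ (m - 2) - (m : ℝ) ^ 2 * Real.cos t ^ m := by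
  have h1 : deriv (fun t : ℝ => Real.cos t ^ m) =
      fun t => (m : ℝ) * Real.cos t ^ (m - 1) * (-Real.sin t) := by
    ext t
    exact ((Real.hasDerivAt_cos t).fun_pow m).deriv
  rw [iteratedDeriv_succ, iteratedDeriv_one, h1]
  ext t
  have h2 := ((((Real.hasDerivAt_cos t).fun_pow (m - 1)).const_mul (m : ℝ)).fun_mul
    (Real.hasDerivAt_sin t).fun_neg)
  rw [h2.deriv]
  have hs : Real.sin t ^ 2 = 1 - Real.cos t ^ 2 := by
    linarith [Real.sin_sq_add_cos_sq t]
  -- For `m ≤ 1` the factor `m (m - 1)` is zero, so the truncated exponent `m - 2` is harmless.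
  rcases m with _ | _ | m
  · simp
  · simp
  · simp only [Nat.add_sub_cancel, show m + 1 + 1 - 1 = m + 1 by omega,
      show m + 1 + 1 - 2 = m by omega]
    push_cast
    linear_combination ((m : ℝ) + 2) * (m + 1) * Real.cos t ^ m * hs

theorem iteratedDeriv_four_cos_pow_zero {d : ℕ} (hd : 1 < d) :
    iteratedDeriv 2 (iteratedDeriv 2 (fun t : ℝ => Real.cos t ^ d)) 0 =
      3 * (d : ℝ) ^ 2 - 2 * d := by
  have hc : ∀ m : ℕ, ContDiff ℝ 2 (fun t : ℝ => Real.cos t ^ m) := fun m => by fun_prop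
  rw [iteratedDeriv_two_cos_pow, iteratedDeriv_fun_sub (by fun_prop) (by fun_prop),
    iteratedDeriv_const_mul_field, iteratedDeriv_const_mul_field,
    iteratedDeriv_two_cos_pow, iteratedDeriv_two_cos_pow]
  simp only [Real.cos_zero, one_pow]
  obtain ⟨e, rfl⟩ : ∃ e, d = e + 2 := ⟨d - 2, by omega⟩
  simp only [Nat.add_sub_cancel]
  push_cast
  ring

/-- The point at time `t` of the great circle through the orthonormal vectors `u` and `v`. -/
noncomputable def greatCircle {n : ℕ} (u v : EuclideanSpace ℝ (Fin n)) (t : ℝ) :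
    EuclideanSpace ℝ (Fin n) :=
  Real.cos t • u + Real.sin t • v

theorem sum_greatCircle_mul {n : ℕ} {u v : EuclideanSpace ℝ (Fin n)} (hu : ‖u‖ = 1)
    (hv : ‖v‖ = 1) (huv : inner ℝ u v = 0) (s t : ℝ) :
    ∑ i, greatCircle u v s i * greatCircle u v t i = Real.cos (s - t) := by
  have h : inner ℝ (greatCircle u v t) (greatCircle u v s) = Real.cos (s - t) := by
    have hvu : inner ℝ v u = 0 := by rw [real_inner_comm, huv]
    simp only [greatCircle, inner_add_left, inner_add_right, real_inner_smul_left,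
      real_inner_smul_right, real_inner_self_eq_norm_sq, hu, hv, huv, hvu, Real.cos_sub]
    ring
  rw [← h, PiLp.inner_apply]
  simp

theorem norm_greatCircle {n : ℕ} {u v : EuclideanSpace ℝ (Fin n)} (hu : ‖u‖ = 1)
    (hv : ‖v‖ = 1) (huv : inner ℝ u v = 0) (t : ℝ) : ‖greatCircle u v t‖ = 1 := by
  have h := sum_greatCircle_mul hu hv huv t t
  have h2 := EuclideanSpace.real_norm_sq_eq (greatCircle u v t)
  simp only [← sq] at h
  rw [h, sub_self, Real.cos_zero] at h2
  exact (pow_eq_one_iff_of_nonneg (norm_nonneg _) two_ne_zero).1 h2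

theorem continuous_greatCircle {n : ℕ} (u v : EuclideanSpace ℝ (Fin n)) :
    Continuous (greatCircle u v) := by
  unfold greatCircle
  fun_prop

theorem contDiff_prod_greatCircle {n : ℕ} (u v : EuclideanSpace ℝ (Fin n)) (k : Fin n → ℕ) :
    ContDiff ℝ 2 fun t => ∏ i, greatCircle u v t i ^ k i := by
  simp only [greatCircle, PiLp.add_apply, PiLp.smul_apply, smul_eq_mul]
  fun_prop

/-- This is the squared norm of the functional sending a form to its second derivative at time `t`.
On the circle the kernel is `cos (s - r) ^ d`; two derivatives in each variable at `s = r = t` give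
the fourth derivative of `cos ^ d` at `0`. -/
theorem sum_multinomial_iteratedDeriv_sq {n d : ℕ} (hd : 1 < d)
    {u v : EuclideanSpace ℝ (Fin n)} (hu : ‖u‖ = 1) (hv : ‖v‖ = 1) (huv : inner ℝ u v = 0)
    (t : ℝ) :
    ∑ k ∈ Finset.piAntidiag Finset.univ d, (Nat.multinomial Finset.univ k : ℝ) *
      iteratedDeriv 2 (fun s => ∏ i, greatCircle u v s i ^ k i) t ^ 2 =
      3 * (d : ℝ) ^ 2 - 2 * d := by
  set w : (Fin n → ℕ) → ℝ := fun k => (Nat.multinomial Finset.univ k : ℝ)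
  set φ : (Fin n → ℕ) → ℝ → ℝ := fun k s => ∏ i, greatCircle u v s i ^ k i with hφ
  have hφc : ∀ k, ContDiff ℝ 2 (φ k) := contDiff_prod_greatCircle u v
  set c : ℝ → ℝ := fun r => Real.cos r ^ d with hc
  have key : ∀ s r, ∑ k ∈ Finset.piAntidiag Finset.univ d, (w k * φ k s) * φ k r = c (s - r) := by
    intro s r
    have h := sum_multinomial_mul_prod_pow d (fun i => greatCircle u v s i)
      (fun i => greatCircle u v r i)
    rw [sum_greatCircle_mul hu hv huv] at h
    refine Eq.trans ?_ h
    exact Finset.sum_congr rfl fun k _ => mul_assoc _ _ _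
  have key1 : ∀ s, ∑ k ∈ Finset.piAntidiag Finset.univ d,
      (w k * iteratedDeriv 2 (φ k) t) * φ k s = iteratedDeriv 2 c (s - t) := by
    intro s
    have h := congrArg (fun g => iteratedDeriv 2 g t) (funext (key s))
    simp only [iteratedDeriv_comp_const_sub] at h
    rw [iteratedDeriv_fun_sum fun k _ => (contDiff_const.mul (hφc k)).contDiffAt] at h
    simp only [iteratedDeriv_const_mul_field] at h
    rw [show iteratedDeriv 2 c (s - t) = (-1 : ℝ) ^ 2 • iteratedDeriv 2 c (s - t) by simp, ← h]
    exact Finset.sum_congr rfl fun k _ => by ring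
  have h := congrArg (fun g => iteratedDeriv 2 g t) (funext key1)
  simp only [iteratedDeriv_comp_sub_const] at h
  rw [iteratedDeriv_fun_sum fun k _ => (contDiff_const.mul (hφc k)).contDiffAt] at h
  simp only [iteratedDeriv_const_mul_field, sub_self] at h
  rw [hc, iteratedDeriv_four_cos_pow_zero hd] at h
  rw [← h]
  exact Finset.sum_congr rfl fun k _ => by ring

theorem contDiff_eval_greatCircle {n d : ℕ} {P : MvPolynomial (Fin n) ℝ}
    (hP : P.IsHomogeneous d) (u v : EuclideanSpace ℝ (Fin n)) :
    ContDiff ℝ 2 fun t => eval (fun i => greatCircle u v t i) P := by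
  simp only [eval_eq_sum_coeffAt hP]
  exact ContDiff.sum fun k _ => contDiff_const.mul (contDiff_prod_greatCircle u v k)

/-- The second derivative of a form along a great circle is bounded by `d ^ 2` times its Bombieri
norm. -/
theorem abs_iteratedDeriv_eval_greatCircle_le {n d : ℕ} (hd : 1 < d)
    {P : MvPolynomial (Fin n) ℝ} (hP : P.IsHomogeneous d)
    {u v : EuclideanSpace ℝ (Fin n)} (hu : ‖u‖ = 1) (hv : ‖v‖ = 1) (huv : inner ℝ u v = 0)
    (t : ℝ) :
    |iteratedDeriv 2 (fun s => eval (fun i => greatCircle u v s i) P) t| ≤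
      d ^ 2 * bombieriNorm P := by
  simp only [eval_eq_sum_coeffAt hP]
  rw [iteratedDeriv_fun_sum fun k _ =>
    (contDiff_const.mul (contDiff_prod_greatCircle u v k)).contDiffAt]
  simp only [iteratedDeriv_const_mul_field]
  refine abs_le_of_sq_le_sq ?_ (mul_nonneg (sq_nonneg _) (bombieriNorm_nonneg _))
  refine (sum_coeffAt_mul_sq_le hP _).trans ?_
  rw [sum_multinomial_iteratedDeriv_sq hd hu hv huv, mul_pow, mul_comm]
  refine mul_le_mul_of_nonneg_right ?_ (sq_nonneg _)
  have hd' : (2 : ℝ) ≤ d := by exact_mod_cast hd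
  -- This product equals `d⁴ - (3 d² - 2 d)`.
  have h1 : (0 : ℝ) ≤ d * (d - 1) ^ 2 * (d + 2) := by positivity
  nlinarith [h1]

/-- A function vanishing at both ends of `[0, θ]` whose second derivative is bounded by `M` is
bounded by `M θ² / 8`. -/
theorem le_of_iteratedDeriv_two_bound {f : ℝ → ℝ} (hf : ContDiff ℝ 2 f) {M θ : ℝ}
    (hM : ∀ t, |iteratedDeriv 2 f t| ≤ M) (h0 : f 0 = 0) (hθ : f θ = 0) {t : ℝ}
    (ht : t ∈ Set.Icc 0 θ) : f t ≤ M * θ ^ 2 / 8 := by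
  -- The parabola has second derivative `-M` and maximum `M θ² / 8`. The difference `g` is concave
  -- and zero at both ends, hence nonnegative between them.
  set g : ℝ → ℝ := fun t => M * (t * (θ - t)) / 2 - f t with hg
  have hfd : Differentiable ℝ f := hf.differentiable (by norm_num)
  have hfd' : Differentiable ℝ (deriv f) := by
    have := hf.differentiable_iteratedDeriv 1 (by norm_num)
    rwa [iteratedDeriv_one] at this
  have hg1 : deriv g = fun t => M * (θ - 2 * t) / 2 - deriv f t := by
    ext t
    have h := ((((hasDerivAt_id t).fun_mul ((hasDerivAt_id t).const_sub θ)).const_mul M).div_const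
      2).fun_sub (hfd t).hasDerivAt
    refine (h.congr_deriv ?_).deriv
    simp only [id]
    ring
  have hg2 : ∀ t, deriv (deriv g) t = -M - iteratedDeriv 2 f t := by
    intro t
    rw [hg1, iteratedDeriv_succ, iteratedDeriv_one]
    have h := (((((hasDerivAt_id t).const_mul 2).const_sub θ).const_mul M).div_const
      2).fun_sub (hfd' t).hasDerivAt
    refine (h.congr_deriv ?_).deriv
    ring
  have hconc : ConcaveOn ℝ Set.univ g := by
    refine concaveOn_univ_of_deriv2_nonpos ?_ ?_ fun t => ?_
    · rw [hg]; fun_prop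
    · rw [hg1]; fun_prop
    · rw [Function.iterate_succ, Function.iterate_one, Function.comp_apply, hg2]
      linarith [neg_abs_le (iteratedDeriv 2 f t), hM t]
  have hM0 : 0 ≤ M := (abs_nonneg _).trans (hM 0)
  have hmin : 0 ≤ g t := by
    have h := hconc.min_le_of_mem_Icc (Set.mem_univ 0) (Set.mem_univ θ) ht
    simpa [hg, h0, hθ] using h
  have h2 : t * (θ - t) ≤ θ ^ 2 / 4 := by nlinarith [sq_nonneg (θ - 2 * t)]
  have h3 := mul_le_mul_of_nonneg_left h2 hM0
  simp only [hg] at hmin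
  linarith

/-- Between two zeros at distance `θ` along a great circle, a form of degree `d` is at most
`d² ‖P‖ θ² / 8`. -/
theorem abs_eval_greatCircle_le {n d : ℕ} (hd : 1 < d)
    {P : MvPolynomial (Fin n) ℝ} (hP : P.IsHomogeneous d)
    {u v : EuclideanSpace ℝ (Fin n)} (hu : ‖u‖ = 1) (hv : ‖v‖ = 1) (huv : inner ℝ u v = 0)
    {θ : ℝ} (h0 : eval (fun i => greatCircle u v 0 i) P = 0)
    (hθ : eval (fun i => greatCircle u v θ i) P = 0) {t : ℝ} (ht : t ∈ Set.Icc 0 θ) :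
    |eval (fun i => greatCircle u v t i) P| ≤ d ^ 2 * bombieriNorm P * θ ^ 2 / 8 := by
  have hc := contDiff_eval_greatCircle hP u v
  have hM := abs_iteratedDeriv_eval_greatCircle_le hd hP hu hv huv
  rw [abs_le']
  refine ⟨le_of_iteratedDeriv_two_bound hc hM h0 hθ ht, ?_⟩
  refine le_of_iteratedDeriv_two_bound hc.neg (fun t => ?_) (by simp [h0]) (by simp [hθ]) ht
  rw [iteratedDeriv_fun_neg, abs_neg]
  exact hM t

/-! ### The contracting gradient step -/

theorem hasDerivAt_eval_curve {σ : Type*} [Fintype σ] (P : MvPolynomial σ ℝ) {γ : ℝ → σ → ℝ}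
    {γ' : σ → ℝ} {t : ℝ} (hγ : ∀ i, HasDerivAt (fun s => γ s i) (γ' i) t) :
    HasDerivAt (fun s => eval (γ s) P) (∑ i, γ' i * eval (γ t) (pderiv i P)) t := by
  classical
  induction P using MvPolynomial.induction_on with
  | C a => simpa using hasDerivAt_const t a
  | add p q hp hq =>
    simpa [mul_add, Finset.sum_add_distrib] using hp.fun_add hq
  | mul_X p j hp =>
    have h := hp.fun_mul (hγ j)
    simp only [map_mul, eval_X]
    refine h.congr_deriv ?_
    simp only [Derivation.leibniz, smul_eq_mul, map_add, map_mul, eval_X, pderiv_X, mul_add,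
      Finset.sum_add_distrib, Finset.sum_mul]
    rw [add_comm]
    congr 1
    · rw [Finset.sum_eq_single j]
      · simp [mul_comm]
      · intro i _ hij
        simp [Pi.single_eq_of_ne' hij]
      · simp
    · exact Finset.sum_congr rfl fun i _ => by ring

theorem continuous_eval_coords {n : ℕ} (P : MvPolynomial (Fin n) ℝ) :
    Continuous fun x : EuclideanSpace ℝ (Fin n) => eval (fun i => x i) P :=
  (MvPolynomial.continuous_eval P).comp (by fun_prop)

theorem eval_smul_coords {n d : ℕ} {P : MvPolynomial (Fin n) ℝ} (hP : P.IsHomogeneous d) (r : ℝ)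
    (x : EuclideanSpace ℝ (Fin n)) :
    eval (fun i => (r • x) i) P = r ^ d * eval (fun i => x i) P := by
  rw [eval_eq_sum_coeffAt hP, eval_eq_sum_coeffAt hP, Finset.mul_sum]
  refine Finset.sum_congr rfl fun k hk => ?_
  have hk' : ∑ i, k i = d := by simpa using hk
  simp only [PiLp.smul_apply, smul_eq_mul, mul_pow, Finset.prod_mul_distrib,
    Finset.prod_pow_eq_pow_sum, hk']
  ring

/-- The gradient at `x` of the restriction to the unit sphere of a form `P` of degree `d`. -/
noncomputable def tangentGradient {n : ℕ} (d : ℕ) (P : MvPolynomial (Fin n) ℝ)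
    (x : EuclideanSpace ℝ (Fin n)) : EuclideanSpace ℝ (Fin n) :=
  WithLp.toLp 2 fun i =>
    eval (fun j => x j) (pderiv i P) - d * eval (fun j => x j) P * x i

theorem tangentGradient_apply {n : ℕ} (d : ℕ) (P : MvPolynomial (Fin n) ℝ)
    (x : EuclideanSpace ℝ (Fin n)) (i : Fin n) : tangentGradient d P x i =
      eval (fun j => x j) (pderiv i P) - d * eval (fun j => x j) P * x i := rfl

theorem continuous_tangentGradient {n : ℕ} (d : ℕ) (P : MvPolynomial (Fin n) ℝ) :
    Continuous (tangentGradient d P) := by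
  have h := continuous_eval_coords P
  have h' := fun i => continuous_eval_coords (pderiv i P)
  unfold tangentGradient
  refine (PiLp.continuous_toLp 2 _).comp (continuous_pi fun i => ?_)
  exact (h' i).sub ((continuous_const.mul h).mul (by fun_prop))

/-- By Euler's identity the radial part of the gradient on the sphere is `d P(x) x`, which the
tangent gradient removes. -/
theorem sum_mul_tangentGradient {n d : ℕ} {P : MvPolynomial (Fin n) ℝ} (hP : P.IsHomogeneous d)
    {x : EuclideanSpace ℝ (Fin n)} (hx : ‖x‖ = 1) : ∑ i, x i * tangentGradient d P x i = 0 := by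
  have h := congrArg (eval fun j => x j) hP.sum_X_mul_pderiv
  simp only [map_sum, map_mul, eval_X, nsmul_eq_mul, map_natCast] at h
  have hxx := sum_mul_self_of_norm_eq_one hx
  calc ∑ i, x i * tangentGradient d P x i
      = ∑ i, x i * eval (fun j => x j) (pderiv i P)
        - d * eval (fun j => x j) P * ∑ i, x i * x i := by
        rw [Finset.mul_sum, ← Finset.sum_sub_distrib]
        exact Finset.sum_congr rfl fun i _ => by rw [tangentGradient_apply]; ring
    _ = 0 := by rw [hxx, h]; ring

theorem sum_tangentGradient_mul_eval_pderiv {n d : ℕ} {P : MvPolynomial (Fin n) ℝ}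
    (hP : P.IsHomogeneous d) {x : EuclideanSpace ℝ (Fin n)} (hx : ‖x‖ = 1) :
    ∑ i, tangentGradient d P x i * eval (fun j => x j) (pderiv i P) =
      ‖tangentGradient d P x‖ ^ 2 := by
  rw [EuclideanSpace.real_norm_sq_eq]
  have h := sum_mul_tangentGradient hP hx
  calc _ = ∑ i, tangentGradient d P x i ^ 2 +
        d * eval (fun j => x j) P * ∑ i, x i * tangentGradient d P x i := by
        rw [Finset.mul_sum, ← Finset.sum_add_distrib]
        refine Finset.sum_congr rfl fun i _ => ?_
        linear_combination (-tangentGradient d P x i) * tangentGradient_apply d P x i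
    _ = _ := by rw [h]; ring

/-- Pythagoras for a tangential step. Projecting back to the sphere therefore divides by a norm at
least `1`, which cannot increase `|P|`. -/
theorem one_le_norm_sub_smul_tangentGradient {n d : ℕ} {P : MvPolynomial (Fin n) ℝ}
    (hP : P.IsHomogeneous d) {x : EuclideanSpace ℝ (Fin n)} (hx : ‖x‖ = 1) (a : ℝ) :
    1 ≤ ‖x - a • tangentGradient d P x‖ := by
  have h : inner ℝ x (tangentGradient d P x) = 0 := by
    rw [PiLp.inner_apply, ← sum_mul_tangentGradient hP hx]
    exact Finset.sum_congr rfl fun i _ => by simp [mul_comm]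
  have h2 := norm_sub_sq_real x (a • tangentGradient d P x)
  rw [real_inner_smul_right, h, hx] at h2
  refine (one_le_sq_iff₀ (norm_nonneg _)).1 ?_
  rw [h2]
  nlinarith [sq_nonneg ‖a • tangentGradient d P x‖]

/-- Minus the derivative of `P` at `x - a • g` in the direction `-g`, where `g` is the tangent
gradient of `P` at `x`. -/
noncomputable def descentSlope {n : ℕ} (d : ℕ) (P : MvPolynomial (Fin n) ℝ)
    (x : EuclideanSpace ℝ (Fin n)) (a : ℝ) : ℝ :=
  ∑ i, tangentGradient d P x i * eval (fun j => (x - a • tangentGradient d P x) j) (pderiv i P)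

theorem continuous_descentSlope {n : ℕ} (d : ℕ) (P : MvPolynomial (Fin n) ℝ) :
    Continuous fun z : EuclideanSpace ℝ (Fin n) × ℝ => descentSlope d P z.1 z.2 := by
  have hg := continuous_tangentGradient d P
  unfold descentSlope
  refine continuous_finsetSum _ fun i _ => Continuous.mul ?_ ?_
  · exact (PiLp.continuous_apply 2 _ i).comp (hg.comp continuous_fst)
  · exact (continuous_eval_coords (pderiv i P)).comp
      (continuous_fst.sub (continuous_snd.smul (hg.comp continuous_fst)))

/-- The mean value theorem on the segment of the step. -/
theorem exists_eval_sub_smul_tangentGradient {n : ℕ} (d : ℕ) (P : MvPolynomial (Fin n) ℝ)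
    (x : EuclideanSpace ℝ (Fin n)) (b : ℝ) :
    ∃ ξ ∈ Set.Ioo (0 : ℝ) 1, eval (fun j => (x - b • tangentGradient d P x) j) P =
      eval (fun j => x j) P - b * descentSlope d P x (ξ * b) := by
  set g := tangentGradient d P x with hg
  have hd : ∀ t : ℝ, HasDerivAt (fun t => eval (fun j => (x - (t * b) • g) j) P)
      (-b * descentSlope d P x (t * b)) t := by
    intro t
    have h := hasDerivAt_eval_curve P (γ := fun t j => (x - (t * b) • g) j)
      (γ' := fun j => -(b * g j)) (t := t) fun i => by
        simp only [PiLp.sub_apply, PiLp.smul_apply, smul_eq_mul]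
        simpa using (((hasDerivAt_id t).mul_const b).mul_const (g i)).const_sub (x i)
    refine h.congr_deriv ?_
    rw [descentSlope, Finset.mul_sum]
    exact Finset.sum_congr rfl fun i _ => by ring
  obtain ⟨ξ, hξ, h⟩ := exists_hasDerivAt_eq_slope _ _ one_pos
    (fun t _ => (hd t).continuousAt.continuousWithinAt) fun t _ => hd t
  refine ⟨ξ, hξ, ?_⟩
  simp only [one_mul, zero_mul, zero_smul, sub_zero, div_one] at h
  linarith

theorem isCompact_sphere_abs_eval_le {n : ℕ} (P : MvPolynomial (Fin n) ℝ) (c : ℝ) :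
    IsCompact {x : EuclideanSpace ℝ (Fin n) | ‖x‖ = 1 ∧ |eval (fun i => x i) P| ≤ c} := by
  refine (isCompact_sphere (0 : EuclideanSpace ℝ (Fin n)) 1).of_isClosed_subset ?_
    fun x hx => by simpa using hx.1
  exact (isClosed_eq continuous_norm continuous_const).inter
    (isClosed_le (continuous_eval_coords P).abs continuous_const)

theorem tangentGradient_ne_zero {n d : ℕ} {P : MvPolynomial (Fin n) ℝ} (hP : P.IsHomogeneous d)
    {x : EuclideanSpace ℝ (Fin n)} (hx : ‖x‖ = 1)
    (hlt : |eval (fun i => x i) P| < distDiscriminant d P) : tangentGradient d P x ≠ 0 := by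
  intro h
  refine hlt.not_ge (distDiscriminant_le_abs_eval hP hx fun i => ?_)
  have h' := tangentGradient_apply d P x i
  rw [h, PiLp.zero_apply] at h'
  linarith

theorem exists_descentSlope_bounds {n d : ℕ} {P : MvPolynomial (Fin n) ℝ}
    (hP : P.IsHomogeneous d) {c : ℝ} (hc : c < distDiscriminant d P) :
    ∃ η > 0, ∃ m > 0, ∃ M > 0, ∀ x : EuclideanSpace ℝ (Fin n), ‖x‖ = 1 →
      |eval (fun i => x i) P| ≤ c → ∀ a : ℝ, |a| ≤ η →
        m ≤ descentSlope d P x a ∧ descentSlope d P x a ≤ M := by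
  set K := {x : EuclideanSpace ℝ (Fin n) | ‖x‖ = 1 ∧ |eval (fun i => x i) P| ≤ c} with hK
  have hKc : IsCompact K := isCompact_sphere_abs_eval_le P c
  have hcont := continuous_descentSlope d P
  -- At `a = 0` the slope is the squared norm of the tangent gradient, positive on `K`; the tube
  -- lemma extends positivity to small `|a|`, uniformly on `K`.
  have hsub : K ×ˢ {(0 : ℝ)} ⊆
      {z : EuclideanSpace ℝ (Fin n) × ℝ | 0 < descentSlope d P z.1 z.2} := by
    rintro ⟨x, a⟩ ⟨hx, rfl⟩
    have h := sum_tangentGradient_mul_eval_pderiv hP hx.1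
    have hne := tangentGradient_ne_zero hP hx.1 (hx.2.trans_lt hc)
    simp only [Set.mem_ofPred_eq, descentSlope, zero_smul, sub_zero, h]
    positivity
  obtain ⟨U, V, -, hV, hKU, h0V, hUV⟩ := generalized_tube_lemma hKc isCompact_singleton
    (isOpen_lt continuous_const hcont) hsub
  obtain ⟨η, hη, hηV⟩ := Metric.nhds_basis_closedBall.mem_iff.1
    (hV.mem_nhds (h0V (Set.mem_singleton 0)))
  have hcomp : IsCompact (K ×ˢ Metric.closedBall (0 : ℝ) η) :=
    hKc.prod (isCompact_closedBall 0 η)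
  rcases (K ×ˢ Metric.closedBall (0 : ℝ) η).eq_empty_or_nonempty with he | hne
  · refine ⟨η, hη, 1, one_pos, 1, one_pos, fun x hx hxc a ha => ?_⟩
    have : (x, a) ∈ K ×ˢ Metric.closedBall (0 : ℝ) η := ⟨⟨hx, hxc⟩, by simpa using ha⟩
    simp [he] at this
  · obtain ⟨z, hz, hmin⟩ := hcomp.exists_isMinOn hne hcont.continuousOn
    obtain ⟨z', hz', hmax⟩ := hcomp.exists_isMaxOn hne hcont.continuousOn
    have hpos : ∀ z ∈ K ×ˢ Metric.closedBall (0 : ℝ) η, 0 < descentSlope d P z.1 z.2 :=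
      fun z hz => hUV ⟨hKU hz.1, hηV hz.2⟩
    refine ⟨η, hη, descentSlope d P z.1 z.2, hpos z hz, descentSlope d P z'.1 z'.2, hpos z' hz',
      fun x hx hxc a ha => ?_⟩
    have hmem : (x, a) ∈ K ×ˢ Metric.closedBall (0 : ℝ) η := ⟨⟨hx, hxc⟩, by simpa using ha⟩
    have h1 := isMinOn_iff.1 hmin (x, a) hmem
    have h2 := isMaxOn_iff.1 hmax (x, a) hmem
    exact ⟨h1, h2⟩

/-- Below the distance to the discriminant, a normalised gradient step is a continuous self-map of
`{|P| ≤ c}` on the sphere that fixes the zeros of `P` and contracts `|P|`. -/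
theorem exists_contracting_map {n d : ℕ} {P : MvPolynomial (Fin n) ℝ}
    (hP : P.IsHomogeneous d) {c : ℝ} (hc : c < distDiscriminant d P) :
    ∃ Φ : EuclideanSpace ℝ (Fin n) → EuclideanSpace ℝ (Fin n), ∃ ρ : ℝ, 0 ≤ ρ ∧ ρ < 1 ∧
      ContinuousOn Φ {x | ‖x‖ = 1 ∧ |eval (fun i => x i) P| ≤ c} ∧
      ∀ x, ‖x‖ = 1 → |eval (fun i => x i) P| ≤ c →
        ‖Φ x‖ = 1 ∧ |eval (fun i => Φ x i) P| ≤ ρ * |eval (fun i => x i) P| ∧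
        (eval (fun i => x i) P = 0 → Φ x = x) := by
  obtain ⟨η, hη, m, hm, M, hM, hb⟩ := exists_descentSlope_bounds hP hc
  set p : EuclideanSpace ℝ (Fin n) → ℝ := fun x => eval (fun i => x i) P with hp
  set g := tangentGradient d P with hg
  -- The first bound keeps the step within the range `η` of the slope bounds; the second prevents
  -- `P` from overshooting zero.
  set s : ℝ := min (η / (|c| + 1)) (1 / M) with hs
  have hs0 : 0 < s := by positivity
  have hsη : s * |c| ≤ η := by
    have h1 : s * (|c| + 1) ≤ η := (le_div_iff₀ (by positivity)).1 (min_le_left _ _)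
    nlinarith
  have hsM : s * M ≤ 1 := (le_div_iff₀ hM).1 (min_le_right _ _)
  -- A step length proportional to `P(x)` descends where `P > 0`, ascends where `P < 0` and fixes
  -- the zeros.
  set y : EuclideanSpace ℝ (Fin n) → EuclideanSpace ℝ (Fin n) :=
    fun x => x - (s * p x) • g x with hy
  have hyc : Continuous y := by
    have h1 : Continuous p := continuous_eval_coords P
    have h2 : Continuous g := continuous_tangentGradient d P
    rw [hy]; fun_prop
  have hy1 : ∀ x, ‖x‖ = 1 → 1 ≤ ‖y x‖ := fun x hx =>
    one_le_norm_sub_smul_tangentGradient hP hx _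
  -- A slope `q ≥ m` multiplies `P` by `1 - s q ≤ 1 - s m`. The maximum with `0` gives `ρ ≥ 0`
  -- without comparing `m` and `M`.
  refine ⟨fun x => ‖y x‖⁻¹ • y x, max 0 (1 - s * m), le_max_left _ _,
    max_lt one_pos (by nlinarith [mul_pos hs0 hm]), ?_, ?_⟩
  · refine ContinuousOn.smul (hyc.norm.continuousOn.inv₀ fun x hx => ?_) hyc.continuousOn
    linarith [hy1 x hx.1]
  intro x hx hxc
  have hyx := hy1 x hx
  refine ⟨?_, ?_, ?_⟩
  · rw [norm_smul, norm_inv, norm_norm, inv_mul_cancel₀ (by linarith)]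
  · rw [eval_smul_coords hP, abs_mul, abs_of_nonneg (by positivity)]
    have hinv : ‖y x‖⁻¹ ^ d ≤ 1 := pow_le_one₀ (by positivity) (inv_le_one_of_one_le₀ hyx)
    refine (mul_le_of_le_one_left (abs_nonneg _) hinv).trans ?_
    obtain ⟨ξ, hξ, h⟩ := exists_eval_sub_smul_tangentGradient d P x (s * p x)
    have hξb : |ξ * (s * p x)| ≤ η := by
      rw [abs_mul, abs_mul, abs_of_pos hξ.1, abs_of_pos hs0]
      have h1 : s * |p x| ≤ s * |c| :=
        mul_le_mul_of_nonneg_left (hxc.trans (le_abs_self c)) hs0.le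
      have h2 : 0 ≤ s * |p x| := by positivity
      nlinarith [hξ.2]
    obtain ⟨h1, h2⟩ := hb x hx hxc _ hξb
    set q := descentSlope d P x (ξ * (s * p x))
    have hval : eval (fun i => y x i) P = (1 - s * q) * p x := by
      rw [show eval (fun i => y x i) P = p x - s * p x * q from h]; ring
    have hsq : s * q ≤ 1 := (mul_le_mul_of_nonneg_left h2 hs0.le).trans hsM
    rw [hval, abs_mul, abs_of_nonneg (by linarith)]
    refine mul_le_mul_of_nonneg_right (le_trans ?_ (le_max_right _ _)) (abs_nonneg _)
    linarith [mul_le_mul_of_nonneg_left h1 hs0.le]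
  · intro h0
    have hyx' : y x = x := by simp [hy, hp, h0]
    simp [hyx', hx]

/-- Zeros of `P` joined by a preconnected set on the sphere along which `|P|` stays below the
distance to the discriminant lie in the same component of the zero set. -/
theorem mem_connectedComponentIn_sphereZeros {n d : ℕ} {P : MvPolynomial (Fin n) ℝ}
    (hP : P.IsHomogeneous d) {c : ℝ} (hc : c < distDiscriminant d P)
    {T : Set (EuclideanSpace ℝ (Fin n))} (hT : IsPreconnected T)
    (hTc : ∀ z ∈ T, ‖z‖ = 1 ∧ |eval (fun i => z i) P| ≤ c)
    {x y : EuclideanSpace ℝ (Fin n)} (hxT : x ∈ T) (hyT : y ∈ T)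
    (hx : eval (fun i => x i) P = 0) (hy : eval (fun i => y i) P = 0) :
    y ∈ connectedComponentIn (sphereZeros P) x := by
  obtain ⟨Φ, ρ, hρ0, hρ1, hΦ, h⟩ := exists_contracting_map hP hc
  have hmem := mem_connectedComponentIn_of_contracting (isCompact_sphere_abs_eval_le P c)
    (continuous_eval_coords P) hΦ
    (fun z hz => ⟨(h z hz.1 hz.2).1, (h z hz.1 hz.2).2.1.trans
      ((mul_le_of_le_one_left (abs_nonneg _) hρ1.le).trans hz.2)⟩)
    (fun z hz => (h z hz.1 hz.2).2.2) hρ0 hρ1 (fun z hz => (h z hz.1 hz.2).2.1)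
    hTc hT hxT hyT hx hy
  refine connectedComponentIn_mono x ?_ hmem
  rintro z ⟨hz, hz0⟩
  exact ⟨by simpa using hz.1, hz0⟩

/-! ### Great-circle arcs and the conclusion -/

/-- Every point of the sphere at angle `θ` from `x` lies at time `θ` on a great circle that starts
at `x`. -/
theorem exists_greatCircle_eq {n : ℕ} (hn : 1 < n) {x y : EuclideanSpace ℝ (Fin n)}
    (hx : ‖x‖ = 1) (hy : ‖y‖ = 1) : ∃ v : EuclideanSpace ℝ (Fin n), ‖v‖ = 1 ∧ inner ℝ x v = 0 ∧
      greatCircle x v (InnerProductGeometry.angle x y) = y := by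
  set θ := InnerProductGeometry.angle x y with hθ
  have hcos : inner ℝ x y = Real.cos θ := by
    rw [hθ, InnerProductGeometry.cos_angle, hx, hy]; simp
  have hsin : 0 ≤ Real.sin θ := InnerProductGeometry.sin_angle_nonneg x y
  set w := y - Real.cos θ • x with hw
  have hxw : inner ℝ x w = 0 := by
    rw [hw, inner_sub_right, real_inner_smul_right, real_inner_self_eq_norm_sq, hx, hcos]
    ring
  have hwn : ‖w‖ ^ 2 = Real.sin θ ^ 2 := by
    rw [hw, norm_sub_sq_real, real_inner_smul_right, real_inner_comm, hcos, norm_smul, hx, hy,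
      mul_one, Real.norm_eq_abs, sq_abs]
    linarith [Real.sin_sq_add_cos_sq θ]
  have hwn' : ‖w‖ = Real.sin θ := (pow_left_inj₀ (norm_nonneg _) hsin two_ne_zero).1 hwn
  have hyw : y = Real.cos θ • x + w := by rw [hw]; abel
  -- Here `y = ± x` and does not determine a direction; any unit vector orthogonal to `x` serves,
  -- and one exists since `n > 1`.
  by_cases hs : Real.sin θ = 0
  · have hx0 : x ≠ 0 := fun h => by simp [h] at hx
    have hfin : 0 < Module.finrank ℝ (Submodule.span ℝ {x})ᗮ := by
      have h := Submodule.finrank_add_finrank_orthogonal (Submodule.span ℝ {x})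
      rw [finrank_span_singleton hx0, finrank_euclideanSpace_fin] at h
      omega
    have : Nontrivial (Submodule.span ℝ {x})ᗮ := Module.nontrivial_of_finrank_pos hfin
    obtain ⟨⟨v, hv⟩, hv0⟩ := exists_ne (0 : (Submodule.span ℝ {x})ᗮ)
    have hv0' : ‖v‖ ≠ 0 := by simpa using hv0
    refine ⟨‖v‖⁻¹ • v, ?_, ?_, ?_⟩
    · rw [norm_smul, norm_inv, norm_norm, inv_mul_cancel₀ hv0']
    · rw [real_inner_smul_right, Submodule.mem_orthogonal_singleton_iff_inner_right.1 hv, mul_zero]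
    · have hw0 : w = 0 := norm_eq_zero.1 (hwn'.trans hs)
      rw [greatCircle, hs, zero_smul, hyw, hw0]
  · refine ⟨(Real.sin θ)⁻¹ • w, ?_, ?_, ?_⟩
    · rw [norm_smul, norm_inv, Real.norm_eq_abs, abs_of_nonneg hsin, hwn', inv_mul_cancel₀ hs]
    · rw [real_inner_smul_right, hxw, mul_zero]
    · rw [greatCircle, smul_smul, mul_inv_cancel₀ hs, one_smul, ← hyw]

theorem mainTheorem11 (n d : ℕ) (hn : 1 < n) (hd : 1 < d)
    (P : MvPolynomial (Fin n) ℝ) (hP : P ∈ MvPolynomial.homogeneousSubmodule (Fin n) ℝ d)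
    (hdist : distDiscriminant d P ≠ 0)
    (C D : Set (EuclideanSpace ℝ (Fin n)))
    (hC : IsComponentOf C (sphereZeros P)) (hD : IsComponentOf D (sphereZeros P)) (hCD : C ≠ D) :
    2 / (d : ℝ) * Real.sqrt (2 * distDiscriminant d P / bombieriNorm P) ≤ arcDist C D := by
  obtain ⟨x₀, hx₀, rfl⟩ := hC
  obtain ⟨y₀, hy₀, rfl⟩ := hD
  have hhom : P.IsHomogeneous d := hP
  have hd0 : (0 : ℝ) < d := by positivity
  refine le_csInf ((Set.Nonempty.image2 ⟨x₀, mem_connectedComponentIn hx₀⟩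
    ⟨y₀, mem_connectedComponentIn hy₀⟩)) ?_
  rintro _ ⟨x, hxC, y, hyD, rfl⟩
  have hx := connectedComponentIn_subset _ _ hxC
  have hy := connectedComponentIn_subset _ _ hyD
  have hx1 : ‖x‖ = 1 := by simpa using hx.1
  have hy1 : ‖y‖ = 1 := by simpa using hy.1
  by_contra! hlt
  set θ := InnerProductGeometry.angle x y with hθ
  have hθ0 : 0 ≤ θ := InnerProductGeometry.angle_nonneg x y
  obtain ⟨v, hv, hxv, hvy⟩ := exists_greatCircle_eq hn hx1 hy1
  have hstart : greatCircle x v 0 = x := by simp [greatCircle]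
  have hbound : ∀ t ∈ Set.Icc 0 θ, |eval (fun i => greatCircle x v t i) P| ≤
      d ^ 2 * bombieriNorm P * θ ^ 2 / 8 := fun t ht =>
    abs_eval_greatCircle_le hd hhom hx1 hv hxv (by rw [hstart]; exact hx.2)
      (by rw [hvy]; exact hy.2) ht
  have hc : d ^ 2 * bombieriNorm P * θ ^ 2 / 8 < distDiscriminant d P := by
    have hsq : (d * θ / 2) ^ 2 < 2 * distDiscriminant d P / bombieriNorm P := by
      refine (Real.lt_sqrt (by positivity)).1 ?_
      rw [div_mul_eq_mul_div, lt_div_iff₀ hd0] at hlt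
      linarith
    -- If the norm is `0`, division by zero makes the claimed bound `0`, which no angle undercuts.
    rcases (bombieriNorm_nonneg P).eq_or_lt with h0 | hpos
    · rw [← h0, div_zero] at hsq
      exact absurd hsq (not_lt.2 (sq_nonneg _))
    · rw [lt_div_iff₀ hpos] at hsq
      linarith
  have hmem : y ∈ connectedComponentIn (sphereZeros P) x := by
    refine mem_connectedComponentIn_sphereZeros hhom hc
      (T := greatCircle x v '' Set.Icc 0 θ)
      (isPreconnected_Icc.image _ (continuous_greatCircle x v).continuousOn) ?_
      ⟨0, ⟨le_rfl, hθ0⟩, hstart⟩ ⟨θ, ⟨hθ0, le_rfl⟩, hvy⟩ hx.2 hy.2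
    rintro _ ⟨t, ht, rfl⟩
    exact ⟨norm_greatCircle hx1 hv hxv t, hbound t ht⟩
  exact hCD ((connectedComponentIn_eq hxC).trans
    ((connectedComponentIn_eq hmem).trans (connectedComponentIn_eq hyD).symm))
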